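/- Let $m\ge 0$ be an integer and let $\Omega$ be a set with $|\Omega|=2m+1$. The Odd graph $O_{m+1}$ is the graph whose vertex set $X$ consists of the $m$-subsets of $\Omega$, two distinct vertices being adjacent if and only if they are disjoint; it is connected, and we write $\partial$ for its distance function and $D$ for its diameter. For a vertex $x\in X$ and $0\le i\le D$, let $E_i^*(x)\in \mathrm{Mat}_X(\mathbb{C})$ be the diagonal matrix whose $(y,y)$-entry is $1$ if $\partial(x,y)=i$ and $0$ otherwise. The Terwilliger algebra $\mathcal{T}(x)$ of $O_{m+1}$ with respect to $x$ is the subalgebra of $\mathrm{Mat}_X(\mathbb{C})$ generated by the adjacency matrix of $O_{m+1}$ and $E_0^*(x),E_1^*(x),\dots,E_D^*(x)$. Then for every vertex $x\in X$, $$\dim_{\mathbb{C}}\mathcal{T}(x)=\binom{m+4}{4}.$$ -/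

import Mathlib

/-- The `i`-th dual idempotent `E_i^*(x)` of the graph `G` with respect to the vertex `x`: the diagonal
0-1 matrix whose `(y, y)` entry is `1` exactly when `y` is at distance `i` from `x`. -/
noncomputable def dualIdempotent {X : Type*} [DecidableEq X] (G : SimpleGraph X) (x : X) (i : ℕ) :
    Matrix X X ℂ :=
  Matrix.diagonal fun y => if G.dist x y = i then 1 else 0

open scoped Classical in
/-- The Terwilliger algebra `T(x)` of a finite connected graph `G` with respect to the vertex `x`: the
subalgebra of `Mat_X(ℂ)` generated by the adjacency matrix and `E_0^*(x), …, E_D^*(x)`, where `D`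
is the diameter of `G`. -/
noncomputable def terwilligerAlgebra {X : Type*} [Fintype X] [DecidableEq X] (G : SimpleGraph X)
    (x : X) : Subalgebra ℂ (Matrix X X ℂ) :=
  Algebra.adjoin ℂ ({G.adjMatrix ℂ} ∪ {M | ∃ i : ℕ, i ≤ G.diam ∧ M = dualIdempotent G x i})

/-- The graph on the `m`-subsets of `Ω` in which two distinct vertices are adjacent when they are
disjoint. For `|Ω| = 2m + 1` this is the Odd graph `O_{m+1}`. Distinctness is automatic for `m ≥ 1`;
for `m = 0` it only excludes the loop at the empty set. -/
def oddGraph (Ω : Type*) (m : ℕ) : SimpleGraph {s : Finset Ω // s.card = m} where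
  Adj y z := y ≠ z ∧ Disjoint y.1 z.1
  symm := ⟨fun _ _ h => ⟨h.1.symm, h.2.symm⟩⟩
  loopless := ⟨fun _ h => h.1 rfl⟩

/-! Replace each vertex `y` by its folded difference, the smaller of the symmetric difference of `y`
and `x` and its complement. Vertices become the sets of size `t ≤ m` with `t / 2` elements in `x`
and `(t + 1) / 2` outside. The size is the distance from `x`; adjacency is inclusion between
consecutive levels and disjointness inside level `m` when `m > 0`.

The algebra consists of matrices invariant under the permutations of `Ω` that fix `x`, and the point
is that it contains all of them (`terwilligerAlgebra_eq_stabilizerInvariants`). An orbit of pairs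
`(y, z)` is determined by the two levels and by the two defects, the numbers of elements lost from
`y` to `z` inside `x` and outside it. Matrices with natural entries multiply without cancellation,
so supports of products are compositions of relations. Paths of length two give single exchanges on
either side; composing these with inclusions realizes "defects at most `a` and `b`" on each block of
levels `s ≤ t` (`realizes_block`). These supports are triangular with respect to the defects, so
every invariant matrix on the block is a combination of such matrices. Transposition gives the
blocks with `s > t`.

The dimension is therefore the number of orbits. Levels `s`, `t` allow `min s t / 2 + 1` defects
inside `x` and `(min s t + 1) / 2 + 1` outside, and the sum of the products telescopes by Pascal's
rule. -/

open Finset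

/-! ### Folded differences -/

section FoldedDiff

variable {Ω : Type*} [DecidableEq Ω]

theorem Finset.card_symmDiff_add_two_mul_card_inter (A B : Finset Ω) :
    (symmDiff A B).card + 2 * (A ∩ B).card = A.card + B.card := by
  have h1 := Finset.card_sdiff_add_card_inter A B
  have h2 := Finset.card_sdiff_add_card_inter B A
  have h3 : (symmDiff A B).card = (A \ B).card + (B \ A).card := by
    rw [symmDiff_def, Finset.sup_eq_union, Finset.card_union_of_disjoint]
    exact disjoint_sdiff_sdiff
  rw [Finset.inter_comm B A] at h2
  omega

variable [Fintype Ω]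

/-- The smaller one of the symmetric difference of `y` and `x` and its complement, when the ground
set has `2 * m + 1` elements. -/
def foldedDiff (m : ℕ) (x y : Finset Ω) : Finset Ω :=
  if (symmDiff y x).card ≤ m then symmDiff y x else (symmDiff y x)ᶜ

variable {m : ℕ} {x y z : Finset Ω}

theorem card_foldedDiff_le (hΩ : Fintype.card Ω = 2 * m + 1) : (foldedDiff m x y).card ≤ m := by
  unfold foldedDiff
  split_ifs with h
  · exact h
  · rw [Finset.card_compl]; omega

/-- Since `x` and `y` have equal size, their symmetric difference has `2 * k` elements, `k` of them
in `x`. Its complement has `2 * (m - k) + 1` elements and meets `x` in the `m - k` elements of `y ∩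
x`. -/
theorem foldedDiff_card_inter_and_sdiff (hΩ : Fintype.card Ω = 2 * m + 1) (hx : x.card = m)
    (hy : y.card = m) :
    (foldedDiff m x y ∩ x).card = (foldedDiff m x y).card / 2 ∧
      (foldedDiff m x y \ x).card = ((foldedDiff m x y).card + 1) / 2 := by
  have h0 := Finset.card_inter_add_card_sdiff (foldedDiff m x y) x
  suffices h : (foldedDiff m x y ∩ x).card = (foldedDiff m x y).card / 2 by omega
  have h1 := Finset.card_symmDiff_add_two_mul_card_inter y x
  have h2 := Finset.card_sdiff_add_card_inter x y
  rw [Finset.inter_comm x y] at h2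
  unfold foldedDiff
  split_ifs with h
  · have : symmDiff y x ∩ x = x \ y := by
      ext a; simp only [mem_inter, mem_symmDiff, mem_sdiff]; tauto
    rw [this]; omega
  · have : (symmDiff y x)ᶜ ∩ x = y ∩ x := by
      ext a; simp only [mem_inter, mem_symmDiff, mem_compl]; tauto
    rw [this, Finset.card_compl]; omega

/-- The parity of `t` tells whether a complement was taken: none for even `t`, one for odd `t`. This
dictates the preimage. -/
theorem exists_foldedDiff_eq (hΩ : Fintype.card Ω = 2 * m + 1) (hx : x.card = m)
    {t : ℕ} (ht : t ≤ m) {S : Finset Ω} (h1 : (S ∩ x).card = t / 2)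
    (h2 : (S \ x).card = (t + 1) / 2) :
    ∃ y : Finset Ω, y.card = m ∧ foldedDiff m x y = S := by
  have h0 := Finset.card_inter_add_card_sdiff S x
  have hS : S.card = t := by omega
  have h3 := Finset.card_symmDiff_add_two_mul_card_inter S x
  have h4 : symmDiff (symmDiff S x) x = S := symmDiff_symmDiff_cancel_right x S
  rcases Nat.even_or_odd' t with ⟨k, rfl | rfl⟩
  · refine ⟨symmDiff S x, by omega, ?_⟩
    unfold foldedDiff
    rw [h4, if_pos (by omega)]
  · refine ⟨(symmDiff S x)ᶜ, by rw [Finset.card_compl]; omega, ?_⟩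
    have h5 : symmDiff (symmDiff S x)ᶜ x = Sᶜ := by
      ext a; simp only [mem_symmDiff, mem_compl]; tauto
    unfold foldedDiff
    rw [h5, if_neg (by rw [Finset.card_compl]; omega), compl_compl]

/-- The two copies of `x` cancel, and each complement taken in folding complements the symmetric
difference. For two `m`-sets the symmetric difference is even, so parity later selects the
alternative. -/
theorem card_symmDiff_foldedDiff (hΩ : Fintype.card Ω = 2 * m + 1) (x y z : Finset Ω) :
    (symmDiff (foldedDiff m x y) (foldedDiff m x z)).card = (symmDiff y z).card ∨
      (symmDiff (foldedDiff m x y) (foldedDiff m x z)).card + (symmDiff y z).card = 2 * m + 1 := by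
  have hc := Finset.card_add_card_compl (symmDiff y z)
  rw [hΩ] at hc
  unfold foldedDiff
  split_ifs
  · left; congr 1; ext a; simp only [mem_symmDiff]; tauto
  · right; rw [← hc, add_comm]; congr 2; ext a; simp only [mem_symmDiff, mem_compl]; tauto
  · right; rw [← hc, add_comm]; congr 2; ext a; simp only [mem_symmDiff, mem_compl]; tauto
  · left; congr 1; ext a; simp only [mem_symmDiff, mem_compl]; tauto

theorem foldedDiff_injective (hΩ : Fintype.card Ω = 2 * m + 1) (hy : y.card = m) (hz : z.card = m)
    (h : foldedDiff m x y = foldedDiff m x z) : y = z := by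
  have h1 := card_symmDiff_foldedDiff hΩ x y z
  have h2 := Finset.card_symmDiff_add_two_mul_card_inter y z
  rw [h, symmDiff_self, Finset.bot_eq_empty, Finset.card_empty] at h1
  have h3 : (symmDiff y z).card = 0 := by omega
  rw [Finset.card_eq_zero] at h3
  exact symmDiff_eq_bot.1 h3

/-- On consecutive levels the folded sets have an odd symmetric difference, which forces the second
alternative. The count then says that `y ∩ z` has as many elements as the first folded set has
outside the second. -/
theorem disjoint_iff_foldedDiff_subset (hΩ : Fintype.card Ω = 2 * m + 1) (hy : y.card = m)
    (hz : z.card = m) (h : (foldedDiff m x z).card = (foldedDiff m x y).card + 1) :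
    Disjoint y z ↔ foldedDiff m x y ⊆ foldedDiff m x z := by
  have h1 := card_symmDiff_foldedDiff hΩ x y z
  have h2 := Finset.card_symmDiff_add_two_mul_card_inter y z
  have h3 := Finset.card_symmDiff_add_two_mul_card_inter (foldedDiff m x y) (foldedDiff m x z)
  have h4 := Finset.card_sdiff_add_card_inter (foldedDiff m x y) (foldedDiff m x z)
  rw [Finset.disjoint_iff_inter_eq_empty, ← Finset.sdiff_eq_empty_iff_subset,
    ← Finset.card_eq_zero, ← Finset.card_eq_zero]
  omega

theorem disjoint_iff_disjoint_foldedDiff (hΩ : Fintype.card Ω = 2 * m + 1) (hy : y.card = m)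
    (hz : z.card = m) (h : (foldedDiff m x y).card = m) (h' : (foldedDiff m x z).card = m) :
    Disjoint y z ↔ Disjoint (foldedDiff m x y) (foldedDiff m x z) := by
  have h1 := card_symmDiff_foldedDiff hΩ x y z
  have h2 := Finset.card_symmDiff_add_two_mul_card_inter y z
  have h3 := Finset.card_symmDiff_add_two_mul_card_inter (foldedDiff m x y) (foldedDiff m x z)
  rw [Finset.disjoint_iff_inter_eq_empty, Finset.disjoint_iff_inter_eq_empty,
    ← Finset.card_eq_zero, ← Finset.card_eq_zero]
  omega

/-- Disjoint `m`-sets have symmetric difference of size `2 * m`, so the folded sets differ in `1` or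
`2 * m` elements. In the latter case both have the maximal size `m`. -/
theorem card_foldedDiff_le_succ_of_disjoint (hΩ : Fintype.card Ω = 2 * m + 1) (hy : y.card = m)
    (hz : z.card = m) (h : Disjoint y z) :
    (foldedDiff m x z).card ≤ (foldedDiff m x y).card + 1 := by
  have h1 := card_symmDiff_foldedDiff hΩ x y z
  have h2 := Finset.card_symmDiff_add_two_mul_card_inter y z
  have h3 := Finset.card_symmDiff_add_two_mul_card_inter (foldedDiff m x y) (foldedDiff m x z)
  have h4 := Finset.card_sdiff_add_card_inter (foldedDiff m x y) (foldedDiff m x z)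
  have h5 := card_foldedDiff_le (x := x) (y := z) hΩ
  have h6 := Finset.card_le_card (Finset.inter_subset_left (s₁ := foldedDiff m x y)
    (s₂ := foldedDiff m x z))
  rw [Finset.disjoint_iff_inter_eq_empty, ← Finset.card_eq_zero] at h
  omega

theorem foldedDiff_map (σ : Equiv.Perm Ω) (hσ : x.map σ.toEmbedding = x) (y : Finset Ω) :
    foldedDiff m x (y.map σ.toEmbedding) = (foldedDiff m x y).map σ.toEmbedding := by
  have h : symmDiff (y.map σ.toEmbedding) x = (symmDiff y x).map σ.toEmbedding := by
    conv_lhs => rw [← hσ]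
    ext a; simp only [mem_symmDiff, mem_map_equiv]
  unfold foldedDiff
  rw [h, Finset.card_map]
  split_ifs
  · rfl
  · ext a; simp only [mem_compl, mem_map_equiv]

end FoldedDiff

/-! ### Distance and adjacency in terms of folded differences -/

section OddGraph

theorem Finset.exists_between_card_inter {Ω : Type*} [DecidableEq Ω] [Fintype Ω] {A B : Finset Ω}
    (hAB : A ⊆ B) (s : Finset Ω) {a b : ℕ} (ha : (A ∩ s).card ≤ a) (ha' : a ≤ (B ∩ s).card)
    (hb : (A ∩ sᶜ).card ≤ b) (hb' : b ≤ (B ∩ sᶜ).card) :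
    ∃ C, A ⊆ C ∧ C ⊆ B ∧ (C ∩ s).card = a ∧ (C ∩ sᶜ).card = b := by
  obtain ⟨P, hP1, hP2, hP3⟩ := Finset.exists_subsuperset_card_eq
    (Finset.inter_subset_inter_right (u := s) hAB) ha ha'
  obtain ⟨Q, hQ1, hQ2, hQ3⟩ := Finset.exists_subsuperset_card_eq
    (Finset.inter_subset_inter_right (u := sᶜ) hAB) hb hb'
  simp only [Finset.subset_iff, mem_inter, mem_compl] at hP1 hP2 hQ1 hQ2
  refine ⟨P ∪ Q, ?_, ?_, ?_, ?_⟩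
  · intro i hi
    by_cases his : i ∈ s
    · exact mem_union_left _ (hP1 ⟨hi, his⟩)
    · exact mem_union_right _ (hQ1 ⟨hi, his⟩)
  · intro i hi
    rcases mem_union.1 hi with hi | hi
    · exact (hP2 hi).1
    · exact (hQ2 hi).1
  · rw [← hP3]; congr 1; ext i
    have := @hP2 i; have := @hQ2 i
    simp only [mem_inter, mem_union]; tauto
  · rw [← hQ3]; congr 1; ext i
    have := @hP2 i; have := @hQ2 i
    simp only [mem_inter, mem_union, mem_compl]; tauto

theorem oddGraph_adj_iff_disjoint {Ω : Type*} {m : ℕ} (hm : 0 < m)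
    {y z : {s : Finset Ω // s.card = m}} : (oddGraph Ω m).Adj y z ↔ Disjoint y.1 z.1 := by
  refine ⟨fun h => h.2, fun h => ⟨?_, h⟩⟩
  rintro rfl
  rw [disjoint_self, Finset.bot_eq_empty] at h
  have := y.2
  rw [h, Finset.card_empty] at this
  omega

variable {m : ℕ} {Ω : Type*} [DecidableEq Ω] [Fintype Ω]

/-- The folded difference of two vertices of the Odd graph. -/
abbrev oddFold (x y : {s : Finset Ω // s.card = m}) : Finset Ω := foldedDiff m x.1 y.1

variable {x y z w : {s : Finset Ω // s.card = m}}

theorem oddFold_self : oddFold x x = ∅ := by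
  simp [oddFold, foldedDiff]

theorem oddFold_injective (hΩ : Fintype.card Ω = 2 * m + 1) (h : oddFold x y = oddFold x z) :
    y = z :=
  Subtype.ext (foldedDiff_injective hΩ y.2 z.2 h)

theorem card_oddFold_inter (hΩ : Fintype.card Ω = 2 * m + 1)
    (x y : {s : Finset Ω // s.card = m}) :
    (oddFold x y ∩ x.1).card = (oddFold x y).card / 2 :=
  (foldedDiff_card_inter_and_sdiff hΩ x.2 y.2).1

theorem card_oddFold_inter_compl (hΩ : Fintype.card Ω = 2 * m + 1)
    (x y : {s : Finset Ω // s.card = m}) :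
    (oddFold x y ∩ x.1ᶜ).card = ((oddFold x y).card + 1) / 2 := by
  rw [← Finset.sdiff_eq_inter_compl]
  exact (foldedDiff_card_inter_and_sdiff hΩ x.2 y.2).2

theorem card_oddFold_le (hΩ : Fintype.card Ω = 2 * m + 1)
    (x y : {s : Finset Ω // s.card = m}) : (oddFold x y).card ≤ m :=
  card_foldedDiff_le hΩ

theorem exists_oddFold_eq (hΩ : Fintype.card Ω = 2 * m + 1) (x : {s : Finset Ω // s.card = m})
    {t : ℕ} (ht : t ≤ m) {S : Finset Ω} (h1 : (S ∩ x.1).card = t / 2)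
    (h2 : (S ∩ x.1ᶜ).card = (t + 1) / 2) :
    ∃ y : {s : Finset Ω // s.card = m}, oddFold x y = S := by
  rw [← Finset.sdiff_eq_inter_compl] at h2
  obtain ⟨y, hy, h⟩ := exists_foldedDiff_eq hΩ x.2 ht h1 h2
  exact ⟨⟨y, hy⟩, h⟩

/-- A vertex with prescribed distance whose folded difference lies between two given sets. -/
theorem exists_oddFold_between (hΩ : Fintype.card Ω = 2 * m + 1)
    (x : {s : Finset Ω // s.card = m}) {t : ℕ} (ht : t ≤ m) {A B : Finset Ω} (hAB : A ⊆ B)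
    (ha : (A ∩ x.1).card ≤ t / 2) (ha' : t / 2 ≤ (B ∩ x.1).card)
    (hb : (A ∩ x.1ᶜ).card ≤ (t + 1) / 2) (hb' : (t + 1) / 2 ≤ (B ∩ x.1ᶜ).card) :
    ∃ y : {s : Finset Ω // s.card = m}, (oddFold x y).card = t ∧ A ⊆ oddFold x y ∧
      oddFold x y ⊆ B := by
  obtain ⟨C, h1, h2, h3, h4⟩ := Finset.exists_between_card_inter hAB x.1 ha ha' hb hb'
  obtain ⟨y, hy⟩ := exists_oddFold_eq hΩ x ht h3 h4
  refine ⟨y, ?_, hy ▸ h1, hy ▸ h2⟩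
  have := Finset.card_inter_add_card_sdiff C x.1
  rw [Finset.sdiff_eq_inter_compl] at this
  rw [hy]; omega

theorem oddGraph_adj_iff_subset (hΩ : Fintype.card Ω = 2 * m + 1)
    (h : (oddFold x z).card = (oddFold x y).card + 1) :
    (oddGraph Ω m).Adj y z ↔ oddFold x y ⊆ oddFold x z := by
  have := card_oddFold_le hΩ x z
  rw [oddGraph_adj_iff_disjoint (by omega), disjoint_iff_foldedDiff_subset hΩ y.2 z.2 h]

theorem oddGraph_adj_iff_disjoint_oddFold (hΩ : Fintype.card Ω = 2 * m + 1) (hm : 0 < m)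
    (h : (oddFold x y).card = m) (h' : (oddFold x z).card = m) :
    (oddGraph Ω m).Adj y z ↔ Disjoint (oddFold x y) (oddFold x z) := by
  rw [oddGraph_adj_iff_disjoint hm, disjoint_iff_disjoint_foldedDiff hΩ y.2 z.2 h h']

theorem card_oddFold_le_add_length (hΩ : Fintype.card Ω = 2 * m + 1)
    (x : {s : Finset Ω // s.card = m}) (p : (oddGraph Ω m).Walk y z) :
    (oddFold x z).card ≤ (oddFold x y).card + p.length := by
  induction p with
  | nil => simp
  | @cons u v _ h p ih =>
    have := card_foldedDiff_le_succ_of_disjoint (x := x.1) hΩ u.2 v.2 h.2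
    rw [SimpleGraph.Walk.length_cons]
    simp only [oddFold] at ih ⊢
    omega

theorem exists_walk_length_eq_card_oddFold (hΩ : Fintype.card Ω = 2 * m + 1)
    (x : {s : Finset Ω // s.card = m}) (t : ℕ) : ∀ y, (oddFold x y).card = t →
      ∃ p : (oddGraph Ω m).Walk x y, p.length = t := by
  induction t with
  | zero =>
    intro y hy
    have : x = y := oddFold_injective (x := x) hΩ (by
      rw [oddFold_self, eq_comm]; exact Finset.card_eq_zero.1 hy)
    subst this
    exact ⟨SimpleGraph.Walk.nil, rfl⟩
  | succ t ih =>
    intro y hy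
    have h1 := card_oddFold_inter hΩ x y
    have h2 := card_oddFold_inter_compl hΩ x y
    have h3 := card_oddFold_le hΩ x y
    -- Both `t / 2` and `(t + 1) / 2` are monotone in `t`, so one element can be removed while
    -- keeping the required split between `x` and its complement.
    obtain ⟨z, hz, -, hzy⟩ := exists_oddFold_between hΩ x (t := t) (by omega)
      (Finset.empty_subset (oddFold x y)) (by simp) (by omega) (by simp) (by omega)
    obtain ⟨p, hp⟩ := ih z hz
    have hadj : (oddGraph Ω m).Adj z y :=
      (oddGraph_adj_iff_subset hΩ (x := x) (by omega)).2 hzy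
    exact ⟨p.concat hadj, by rw [SimpleGraph.Walk.length_concat, hp]⟩

theorem oddGraph_dist (hΩ : Fintype.card Ω = 2 * m + 1) (x y : {s : Finset Ω // s.card = m}) :
    (oddGraph Ω m).dist x y = (oddFold x y).card := by
  obtain ⟨p, hp⟩ := exists_walk_length_eq_card_oddFold hΩ x _ y rfl
  apply le_antisymm
  · rw [← hp]; exact SimpleGraph.dist_le p
  · obtain ⟨q, hq⟩ := p.reachable.exists_walk_length_eq_dist
    have := card_oddFold_le_add_length hΩ x q
    rw [oddFold_self, Finset.card_empty] at this
    omega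

theorem oddGraph_connected (hΩ : Fintype.card Ω = 2 * m + 1)
    (x : {s : Finset Ω // s.card = m}) : (oddGraph Ω m).Connected := by
  have h (y) : (oddGraph Ω m).Reachable x y :=
    (exists_walk_length_eq_card_oddFold hΩ x _ y rfl).choose.reachable
  exact { preconnected := fun y z => (h y).symm.trans (h z), nonempty := ⟨x⟩ }

theorem card_oddFold_le_diam (hΩ : Fintype.card Ω = 2 * m + 1)
    (x y : {s : Finset Ω // s.card = m}) : (oddFold x y).card ≤ (oddGraph Ω m).diam := by
  have hc := oddGraph_connected hΩ x
  have := hc.nonempty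
  rw [← oddGraph_dist hΩ]
  exact SimpleGraph.dist_le_diam (SimpleGraph.connected_iff_ediam_ne_top.1 hc)

end OddGraph

/-! ### Defects of pairs and single exchanges -/

section Defect

variable {m : ℕ} {Ω : Type*} [DecidableEq Ω] [Fintype Ω]

/-- The number of elements of `s` that are in the folded difference of `y` but not in that of
`z`. -/
def foldDefect (x : {s : Finset Ω // s.card = m}) (s : Finset Ω)
    (y z : {s : Finset Ω // s.card = m}) : ℕ :=
  ((oddFold x y \ oddFold x z) ∩ s).card

variable {x y z w : {s : Finset Ω // s.card = m}} {s : Finset Ω}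

theorem foldDefect_triangle : foldDefect x s y z ≤ foldDefect x s y w + foldDefect x s w z := by
  unfold foldDefect
  refine (Finset.card_le_card ?_).trans (Finset.card_union_le _ _)
  intro a
  simp only [mem_inter, mem_sdiff, mem_union]
  tauto

theorem foldDefect_eq_zero_of_subset (h : oddFold x y ⊆ oddFold x z) : foldDefect x s y z = 0 := by
  unfold foldDefect
  rw [Finset.sdiff_eq_empty_iff_subset.2 h, Finset.empty_inter, Finset.card_empty]

/-- With the two identities that follow, this shows that inside `s` the sizes of all Venn cells of
the two folded sets depend only on the defect, the sizes of their traces on `s`, and `s.card`. -/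
theorem card_inter_add_foldDefect :
    ((oddFold x y ∩ oddFold x z) ∩ s).card + foldDefect x s y z = (oddFold x y ∩ s).card := by
  unfold foldDefect
  rw [← Finset.card_inter_add_card_sdiff (oddFold x y ∩ s) (oddFold x z)]
  congr 2 <;> ext a <;> simp only [mem_inter, mem_sdiff] <;> tauto

theorem card_inter_add_foldDefect' :
    (oddFold x z ∩ s).card + foldDefect x s y z = ((oddFold x y ∪ oddFold x z) ∩ s).card := by
  unfold foldDefect
  rw [← Finset.card_sdiff_add_card_inter ((oddFold x y ∪ oddFold x z) ∩ s) (oddFold x z), add_comm]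
  congr 2 <;> ext a <;> simp only [mem_inter, mem_sdiff, mem_union] <;> tauto

theorem card_inter_add_foldDefect_compl :
    ((oddFold x y ∪ oddFold x z)ᶜ ∩ s).card + (oddFold x z ∩ s).card + foldDefect x s y z =
      s.card := by
  rw [add_assoc, card_inter_add_foldDefect', ← Finset.card_inter_add_card_sdiff s
    (oddFold x y ∪ oddFold x z), add_comm]
  congr 2 <;> ext a <;> simp only [mem_inter, mem_sdiff, mem_compl] <;> tauto

theorem foldDefect_comm (h : (oddFold x y ∩ s).card = (oddFold x z ∩ s).card) :
    foldDefect x s y z = foldDefect x s z y := by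
  have h1 := card_inter_add_foldDefect (x := x) (y := y) (z := z) (s := s)
  have h2 := card_inter_add_foldDefect (x := x) (y := z) (z := y) (s := s)
  rw [Finset.inter_comm (oddFold x z)] at h2
  omega

theorem eq_of_foldDefect_eq_zero (hΩ : Fintype.card Ω = 2 * m + 1)
    (h : (oddFold x y).card = (oddFold x z).card)
    (h1 : foldDefect x x.1 y z = 0) (h2 : foldDefect x x.1ᶜ y z = 0) : y = z := by
  apply oddFold_injective (x := x) hΩ
  refine Finset.eq_of_subset_of_card_le ?_ h.ge
  unfold foldDefect at h1 h2
  rw [Finset.card_eq_zero] at h1 h2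
  rw [← Finset.sdiff_eq_empty_iff_subset, ← Finset.inter_univ (_ \ _),
    ← Finset.union_compl x.1, Finset.inter_union_distrib_left, h1, h2, Finset.empty_union]

theorem card_oddFold_inter_eq (hΩ : Fintype.card Ω = 2 * m + 1) (hs : s = x.1 ∨ s = x.1ᶜ)
    (h : (oddFold x y).card = (oddFold x z).card) :
    (oddFold x y ∩ s).card = (oddFold x z ∩ s).card := by
  rcases hs with rfl | rfl
  · rw [card_oddFold_inter hΩ, card_oddFold_inter hΩ, h]
  · rw [card_oddFold_inter_compl hΩ, card_oddFold_inter_compl hΩ, h]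

/-- A pair with defect at most `r + 1` on one side is joined through a vertex reducing that defect
by one. -/
theorem exists_foldDefect_step (hΩ : Fintype.card Ω = 2 * m + 1) (hs : s = x.1 ∨ s = x.1ᶜ)
    (h : (oddFold x y).card = (oddFold x z).card) {r b : ℕ}
    (h1 : foldDefect x s y z ≤ r + 1) (h2 : foldDefect x sᶜ y z ≤ b) :
    ∃ w, (oddFold x w).card = (oddFold x z).card ∧ foldDefect x s y w ≤ r ∧
      foldDefect x sᶜ y w ≤ b ∧ foldDefect x s w z ≤ 1 ∧ foldDefect x sᶜ w z = 0 := by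
  by_cases hr : foldDefect x s y z ≤ r
  · have h0 (s) : foldDefect x s z z = 0 := foldDefect_eq_zero_of_subset (Finset.Subset.refl _)
    exact ⟨z, rfl, hr, h2, by rw [h0]; omega, h0 _⟩
  have hs' : sᶜ = x.1 ∨ sᶜ = x.1ᶜ := by
    rcases hs with rfl | rfl
    · exact Or.inr rfl
    · exact Or.inl (compl_compl _)
  -- Exchange: `w` arises from `z` by adding `e` and dropping an element of `s` that lies in `z` but
  -- not in `y`. The trace on `sᶜ` is unchanged.
  obtain ⟨e, he⟩ : ((oddFold x y \ oddFold x z) ∩ s).Nonempty := by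
    rw [← Finset.card_pos]; unfold foldDefect at hr; omega
  simp only [mem_inter, mem_sdiff] at he
  obtain ⟨⟨hey, hez⟩, hes⟩ := he
  have hyz := card_oddFold_inter_eq hΩ hs h
  have hA : insert e (oddFold x y ∩ oddFold x z) ⊆ insert e (oddFold x z) :=
    Finset.insert_subset_insert _ Finset.inter_subset_right
  -- There is room for `e` because the left-hand set lies in the folded set of `y`, whose trace on
  -- `s` is as large as that of `z`.
  have hA1 : (insert e (oddFold x y ∩ oddFold x z) ∩ s).card ≤ (oddFold x z ∩ s).card := by
    rw [← hyz]
    refine Finset.card_le_card (Finset.inter_subset_inter_right ?_)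
    exact Finset.insert_subset hey Finset.inter_subset_left
  have hA2 : (insert e (oddFold x y ∩ oddFold x z) ∩ sᶜ).card ≤ (oddFold x z ∩ sᶜ).card := by
    refine Finset.card_le_card ?_
    intro a
    simp only [mem_inter, mem_insert, mem_compl]
    rintro ⟨rfl | ha, ha'⟩
    · exact absurd hes ha'
    · exact ⟨ha.2, ha'⟩
  have hB (u) : (oddFold x z ∩ u).card ≤ (insert e (oddFold x z) ∩ u).card :=
    Finset.card_le_card (Finset.inter_subset_inter_right (Finset.subset_insert _ _))
  obtain ⟨w, hw, hw1, hw2⟩ : ∃ w : {s : Finset Ω // s.card = m},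
      (oddFold x w).card = (oddFold x z).card ∧
      insert e (oddFold x y ∩ oddFold x z) ⊆ oddFold x w ∧
      oddFold x w ⊆ insert e (oddFold x z) := by
    have hx1 := card_oddFold_inter hΩ x z
    have hx2 := card_oddFold_inter_compl hΩ x z
    obtain ⟨hA3, hA4⟩ : (insert e (oddFold x y ∩ oddFold x z) ∩ x.1).card ≤
        (oddFold x z ∩ x.1).card ∧ (insert e (oddFold x y ∩ oddFold x z) ∩ x.1ᶜ).card ≤
        (oddFold x z ∩ x.1ᶜ).card := by
      rcases hs with rfl | rfl
      · exact ⟨hA1, hA2⟩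
      · rw [compl_compl] at hA2
        exact ⟨hA2, hA1⟩
    rw [hx1] at hA3
    rw [hx2] at hA4
    exact exists_oddFold_between hΩ x (card_oddFold_le hΩ x z) hA hA3 (hx1 ▸ hB x.1) hA4
      (hx2 ▸ hB x.1ᶜ)
  have hwz : foldDefect x sᶜ w z = 0 := by
    unfold foldDefect
    rw [Finset.card_eq_zero, ← Finset.subset_empty]
    intro a
    simp only [mem_inter, mem_sdiff, mem_compl]
    rintro ⟨⟨ha, ha'⟩, has⟩
    rcases Finset.mem_insert.1 (hw2 ha) with rfl | h'
    · exact absurd hes has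
    · exact absurd h' ha'
  refine ⟨w, hw, ?_, ?_, ?_, hwz⟩
  · have hlt : foldDefect x s y w < foldDefect x s y z := by
      unfold foldDefect
      refine Finset.card_lt_card ((Finset.ssubset_iff_of_subset ?_).2 ⟨e, ?_, ?_⟩)
      · refine Finset.inter_subset_inter_right fun a ha => ?_
        rw [mem_sdiff] at ha ⊢
        exact ⟨ha.1, fun h' => ha.2 (hw1 (mem_insert_of_mem (mem_inter.2 ⟨ha.1, h'⟩)))⟩
      · exact mem_inter.2 ⟨mem_sdiff.2 ⟨hey, hez⟩, hes⟩
      · intro h'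
        exact (mem_sdiff.1 (mem_inter.1 h').1).2 (hw1 (mem_insert_self e _))
    omega
  · have h3 : foldDefect x sᶜ y w ≤ foldDefect x sᶜ y z + foldDefect x sᶜ z w :=
      foldDefect_triangle
    rw [foldDefect_comm (card_oddFold_inter_eq hΩ hs' hw.symm), hwz] at h3
    omega
  · rw [← Finset.card_singleton e]
    refine Finset.card_le_card fun a ha => ?_
    obtain ⟨ha, ha'⟩ := mem_sdiff.1 (mem_inter.1 ha).1
    exact mem_singleton.2 ((mem_insert.1 (hw2 ha)).resolve_right ha')

end Defect

/-! ### Supports of natural number matrices -/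

section Realizes

variable {X : Type*} [Fintype X] [DecidableEq X]

/-- A relation is realized by a matrix algebra when it is the support of a natural number matrix
in the algebra. -/
def Realizes (T : Subalgebra ℂ (Matrix X X ℂ)) (R : X → X → Prop) : Prop :=
  ∃ N : Matrix X X ℕ, N.map (Nat.castRingHom ℂ) ∈ T ∧ ∀ y z, N y z ≠ 0 ↔ R y z

variable {T : Subalgebra ℂ (Matrix X X ℂ)} {R R' : X → X → Prop}

theorem Realizes.congr (h : Realizes T R) (h' : ∀ y z, R y z ↔ R' y z) : Realizes T R' := by
  obtain ⟨N, hN, hR⟩ := h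
  exact ⟨N, hN, fun y z => (hR y z).trans (h' y z)⟩

/-- Over `ℕ` an entry of a product vanishes only if every summand does, so nothing cancels. -/
theorem Realizes.comp (h : Realizes T R) (h' : Realizes T R') :
    Realizes T (fun y z => ∃ w, R y w ∧ R' w z) := by
  obtain ⟨N, hN, hR⟩ := h
  obtain ⟨N', hN', hR'⟩ := h'
  refine ⟨N * N', ?_, fun y z => ?_⟩
  · rw [Matrix.map_mul]; exact T.mul_mem hN hN'
  · rw [Matrix.mul_apply, Ne, Finset.sum_eq_zero_iff]
    push Not
    simp only [← hR, ← hR', mem_univ, true_and, mul_ne_zero_iff]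

/-- A matrix supported on a set of pairs on which it depends only on a numerical key lies in any
algebra that for every key contains a matrix which is triangular with respect to the key. -/
theorem mem_of_triangular (B : X → X → Prop) (κ : X → X → ℕ)
    (hT : ∀ y₀ z₀, B y₀ z₀ → ∃ Z ∈ T, (∀ y z, Z y z ≠ 0 → B y z ∧ κ y z ≤ κ y₀ z₀) ∧
      Z y₀ z₀ ≠ 0 ∧ ∀ y z y' z', B y z → B y' z' → κ y z = κ y' z' → Z y z = Z y' z')
    {M : Matrix X X ℂ} (hM : ∀ y z, M y z ≠ 0 → B y z)
    (hM' : ∀ y z y' z', B y z → B y' z' → κ y z = κ y' z' → M y z = M y' z') : M ∈ T := by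
  suffices h : ∀ (n : ℕ) (M : Matrix X X ℂ), (∀ y z, M y z ≠ 0 → B y z ∧ κ y z < n) →
      (∀ y z y' z', B y z → B y' z' → κ y z = κ y' z' → M y z = M y' z') → M ∈ T by
    refine h (univ.sup (fun p : X × X => κ p.1 p.2) + 1) M (fun y z h => ⟨hM y z h, ?_⟩) hM'
    exact Nat.lt_succ_of_le (Finset.le_sup (f := fun p : X × X => κ p.1 p.2) (mem_univ (y, z)))
  intro n
  induction n with
  | zero =>
    intro M hM _
    have : M = 0 := by
      ext y z
      by_contra h
      exact absurd (hM y z h).2 (Nat.not_lt_zero _)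
    rw [this]; exact T.zero_mem
  | succ n ih =>
    intro M hM hM'
    by_cases hB : ∃ y₀ z₀, B y₀ z₀ ∧ κ y₀ z₀ = n
    · obtain ⟨y₀, z₀, h₀, hn⟩ := hB
      obtain ⟨Z, hZ, hZ1, hZ2, hZ3⟩ := hT y₀ z₀ h₀
      -- Both matrices are constant on the pairs with key `n`, so this one scalar clears all of them
      -- at once.
      have : M - (M y₀ z₀ / Z y₀ z₀) • Z ∈ T := by
        refine ih _ (fun y z h => ?_) fun y z y' z' h1 h2 h3 => ?_
        · rw [Matrix.sub_apply, Matrix.smul_apply, smul_eq_mul] at h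
          have hyz : B y z ∧ κ y z ≤ n := by
            by_cases h' : Z y z = 0
            · rw [h', mul_zero, sub_zero] at h
              exact ⟨(hM y z h).1, Nat.le_of_lt_succ (hM y z h).2⟩
            · exact hn ▸ hZ1 y z h'
          refine ⟨hyz.1, lt_of_le_of_ne hyz.2 fun hk => h ?_⟩
          rw [hM' y z y₀ z₀ hyz.1 h₀ (hk.trans hn.symm),
            hZ3 y z y₀ z₀ hyz.1 h₀ (hk.trans hn.symm), div_mul_cancel₀ _ hZ2, sub_self]
        · rw [Matrix.sub_apply, Matrix.sub_apply, Matrix.smul_apply, Matrix.smul_apply,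
            hM' y z y' z' h1 h2 h3, hZ3 y z y' z' h1 h2 h3]
      have h2 := T.add_mem this (T.smul_mem hZ (M y₀ z₀ / Z y₀ z₀))
      rwa [sub_add_cancel] at h2
    · refine ih M (fun y z h => ⟨(hM y z h).1, lt_of_le_of_ne
        (Nat.le_of_lt_succ (hM y z h).2) fun hk => hB ⟨y, z, (hM y z h).1, hk⟩⟩) hM'

theorem transpose_mem_terwilligerAlgebra {G : SimpleGraph X} {x : X} {M : Matrix X X ℂ}
    (hM : M ∈ terwilligerAlgebra G x) : M.transpose ∈ terwilligerAlgebra G x := by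
  classical
  unfold terwilligerAlgebra at hM ⊢
  induction hM using Algebra.adjoin_induction with
  | mem M hM =>
    have : M.transpose = M := by
      rcases hM with rfl | ⟨i, -, rfl⟩
      · exact G.transpose_adjMatrix
      · exact Matrix.diagonal_transpose _
    rw [this]
    exact Algebra.subset_adjoin hM
  | algebraMap r =>
    rw [Matrix.algebraMap_eq_diagonal, Matrix.diagonal_transpose, ← Matrix.algebraMap_eq_diagonal]
    exact Subalgebra.algebraMap_mem _ r
  | add M N _ _ h h' => rw [Matrix.transpose_add]; exact Subalgebra.add_mem _ h h'
  | mul M N _ _ h h' => rw [Matrix.transpose_mul]; exact Subalgebra.mul_mem _ h' h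

theorem realizes_adj (G : SimpleGraph X) (x : X) : Realizes (terwilligerAlgebra G x) G.Adj := by
  classical
  refine ⟨G.adjMatrix ℕ, ?_, fun y z => by simp [SimpleGraph.adjMatrix_apply]⟩
  have : (G.adjMatrix ℕ).map (Nat.castRingHom ℂ) = G.adjMatrix ℂ := by
    ext y z; simp [SimpleGraph.adjMatrix_apply]
  rw [this]
  exact Algebra.subset_adjoin (Or.inl (by rw [Set.mem_singleton_iff]))

end Realizes

/-! ### Relations realized by the Terwilliger algebra -/

section OddGraphRealizes

variable {m : ℕ} {Ω : Type*} [DecidableEq Ω] [Fintype Ω]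

theorem dualIdempotent_oddGraph (hΩ : Fintype.card Ω = 2 * m + 1)
    (x : {s : Finset Ω // s.card = m}) (t : ℕ) :
    dualIdempotent (oddGraph Ω m) x t =
      Matrix.diagonal fun y => if (oddFold x y).card = t then 1 else 0 := by
  simp only [dualIdempotent, oddGraph_dist hΩ]

/-- Beyond the diameter the idempotent is zero, so the bound on the index of the generators is
harmless. -/
theorem dualIdempotent_mem (hΩ : Fintype.card Ω = 2 * m + 1)
    (x : {s : Finset Ω // s.card = m}) (t : ℕ) :
    dualIdempotent (oddGraph Ω m) x t ∈ terwilligerAlgebra (oddGraph Ω m) x := by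
  by_cases h : t ≤ (oddGraph Ω m).diam
  · exact Algebra.subset_adjoin (Or.inr ⟨t, h, rfl⟩)
  · have : dualIdempotent (oddGraph Ω m) x t = 0 := by
      rw [dualIdempotent_oddGraph hΩ, Matrix.diagonal_eq_zero]
      ext y
      have := card_oddFold_le_diam hΩ x y
      exact if_neg (by omega)
    rw [this]
    exact Subalgebra.zero_mem _

theorem realizes_level (hΩ : Fintype.card Ω = 2 * m + 1)
    (x : {s : Finset Ω // s.card = m}) (t : ℕ) :
    Realizes (terwilligerAlgebra (oddGraph Ω m) x)
      fun y z => (oddFold x y).card = t ∧ y = z := by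
  refine ⟨Matrix.diagonal fun y => if (oddFold x y).card = t then 1 else 0, ?_, fun y z => ?_⟩
  · convert dualIdempotent_mem hΩ x t using 1
    rw [dualIdempotent_oddGraph hΩ, Matrix.diagonal_map (map_zero _)]
    congr 1; ext y
    split_ifs <;> simp
  · by_cases h : y = z
    · subst h; simp
    · simp [h]

theorem realizes_adj_levels (hΩ : Fintype.card Ω = 2 * m + 1)
    (x : {s : Finset Ω // s.card = m}) (s t : ℕ) :
    Realizes (terwilligerAlgebra (oddGraph Ω m) x)
      fun y z => (oddFold x y).card = s ∧ (oddFold x z).card = t ∧ (oddGraph Ω m).Adj y z := by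
  refine (((realizes_level hΩ x s).comp (realizes_adj _ x)).comp (realizes_level hΩ x t)).congr
    fun y z => ?_
  constructor
  · rintro ⟨w, ⟨v, ⟨h1, rfl⟩, h2⟩, h3, rfl⟩
    exact ⟨h1, h3, h2⟩
  · rintro ⟨h1, h2, h3⟩
    exact ⟨z, ⟨y, ⟨h1, rfl⟩, h3⟩, h2, rfl⟩

/-- Paths of length two through the previous level. -/
theorem realizes_down_up (hΩ : Fintype.card Ω = 2 * m + 1)
    (x : {s : Finset Ω // s.card = m}) (t : ℕ) :
    Realizes (terwilligerAlgebra (oddGraph Ω m) x) fun y z =>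
      (oddFold x y).card = t + 1 ∧ (oddFold x z).card = t + 1 ∧
        foldDefect x x.1 y z ≤ (t + 1) / 2 - t / 2 ∧
        foldDefect x x.1ᶜ y z ≤ (t + 2) / 2 - (t + 1) / 2 := by
  refine ((realizes_adj_levels hΩ x (t + 1) t).comp (realizes_adj_levels hΩ x t (t + 1))).congr
    fun y z => ?_
  have h1 := card_oddFold_inter hΩ x y
  have h2 := card_oddFold_inter_compl hΩ x y
  have h3 := card_oddFold_le hΩ x y
  have h4 := card_inter_add_foldDefect (x := x) (y := y) (z := z) (s := x.1)
  have h5 := card_inter_add_foldDefect (x := x) (y := y) (z := z) (s := x.1ᶜ)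
  constructor
  · rintro ⟨w, ⟨hy, hw, hyw⟩, -, hz, hwz⟩
    rw [SimpleGraph.adj_comm, oddGraph_adj_iff_subset hΩ (x := x) (by omega)] at hyw
    rw [oddGraph_adj_iff_subset hΩ (x := x) (by omega)] at hwz
    -- A common lower neighbour is a set of level `t` inside the intersection. It exists exactly
    -- when the intersection keeps `t / 2` elements in `x` and `(t + 1) / 2` outside, out of `(t +
    -- 1) / 2` and `(t + 2) / 2`.
    have h6 (s) := Finset.card_le_card (Finset.inter_subset_inter_right (u := s)
      (Finset.subset_inter hyw hwz))
    have h7 := h6 x.1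
    have h8 := h6 x.1ᶜ
    rw [card_oddFold_inter hΩ] at h7
    rw [card_oddFold_inter_compl hΩ] at h8
    refine ⟨hy, hz, ?_, ?_⟩ <;> rw [hy] at h1 h2 <;> rw [hw] at h7 h8 <;> omega
  · rintro ⟨hy, hz, h6, h7⟩
    obtain ⟨w, hw, -, h8⟩ := exists_oddFold_between hΩ x (t := t) (by omega)
      (Finset.empty_subset (oddFold x y ∩ oddFold x z)) (by simp) (by omega) (by simp) (by omega)
    refine ⟨w, ⟨hy, hw, ?_⟩, hw, hz, ?_⟩
    · rw [SimpleGraph.adj_comm, oddGraph_adj_iff_subset hΩ (x := x) (by omega)]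
      exact h8.trans Finset.inter_subset_left
    · rw [oddGraph_adj_iff_subset hΩ (x := x) (by omega)]
      exact h8.trans Finset.inter_subset_right

/-- Paths of length two through the next level. -/
theorem realizes_up_down (hΩ : Fintype.card Ω = 2 * m + 1)
    (x : {s : Finset Ω // s.card = m}) {t : ℕ} (ht : t < m) :
    Realizes (terwilligerAlgebra (oddGraph Ω m) x) fun y z =>
      (oddFold x y).card = t ∧ (oddFold x z).card = t ∧
        foldDefect x x.1 y z ≤ (t + 1) / 2 - t / 2 ∧
        foldDefect x x.1ᶜ y z ≤ (t + 2) / 2 - (t + 1) / 2 := by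
  refine ((realizes_adj_levels hΩ x t (t + 1)).comp (realizes_adj_levels hΩ x (t + 1) t)).congr
    fun y z => ?_
  have h1 := card_oddFold_inter hΩ x z
  have h2 := card_oddFold_inter_compl hΩ x z
  have h4 := card_inter_add_foldDefect' (x := x) (y := y) (z := z) (s := x.1)
  have h5 := card_inter_add_foldDefect' (x := x) (y := y) (z := z) (s := x.1ᶜ)
  constructor
  · rintro ⟨w, ⟨hy, hw, hyw⟩, -, hz, hwz⟩
    rw [oddGraph_adj_iff_subset hΩ (x := x) (by omega)] at hyw
    rw [SimpleGraph.adj_comm, oddGraph_adj_iff_subset hΩ (x := x) (by omega)] at hwz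
    -- Dually, a common upper neighbour contains the union, which must fit into the split of level
    -- `t + 1`.
    have h6 (s) := Finset.card_le_card (Finset.inter_subset_inter_right (u := s)
      (Finset.union_subset hyw hwz))
    have h7 := h6 x.1
    have h8 := h6 x.1ᶜ
    rw [card_oddFold_inter hΩ] at h7
    rw [card_oddFold_inter_compl hΩ] at h8
    refine ⟨hy, hz, ?_, ?_⟩ <;> rw [hz] at h1 h2 <;> rw [hw] at h7 h8 <;> omega
  · rintro ⟨hy, hz, h6, h7⟩
    have h9 := Finset.card_compl x.1
    have h10 := x.2
    rw [hΩ] at h9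
    obtain ⟨w, hw, h8, -⟩ := exists_oddFold_between hΩ x (t := t + 1) (by omega)
      (Finset.subset_univ (oddFold x y ∪ oddFold x z)) (by omega)
      (by rw [Finset.univ_inter]; omega) (by omega) (by rw [Finset.univ_inter]; omega)
    refine ⟨w, ⟨hy, hw, ?_⟩, hw, hz, ?_⟩
    · rw [oddGraph_adj_iff_subset hΩ (x := x) (by omega)]
      exact Finset.subset_union_left.trans h8
    · rw [SimpleGraph.adj_comm, oddGraph_adj_iff_subset hΩ (x := x) (by omega)]
      exact Finset.subset_union_right.trans h8

/-- Paths of length two within the last level. -/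
theorem realizes_last_last (hΩ : Fintype.card Ω = 2 * m + 1)
    (x : {s : Finset Ω // s.card = m}) (hm : 0 < m) :
    Realizes (terwilligerAlgebra (oddGraph Ω m) x) fun y z =>
      (oddFold x y).card = m ∧ (oddFold x z).card = m ∧
        foldDefect x x.1 y z ≤ (m + 1) / 2 - m / 2 ∧
        foldDefect x x.1ᶜ y z ≤ (m + 2) / 2 - (m + 1) / 2 := by
  refine ((realizes_adj_levels hΩ x m m).comp (realizes_adj_levels hΩ x m m)).congr
    fun y z => ?_
  have h1 := card_oddFold_inter hΩ x z
  have h2 := card_oddFold_inter_compl hΩ x z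
  have h4 := card_inter_add_foldDefect_compl (x := x) (y := y) (z := z) (s := x.1)
  have h5 := card_inter_add_foldDefect_compl (x := x) (y := y) (z := z) (s := x.1ᶜ)
  have h9 := Finset.card_compl x.1
  have h10 := x.2
  rw [hΩ] at h9
  constructor
  · rintro ⟨w, ⟨hy, hw, hyw⟩, -, hz, hwz⟩
    rw [SimpleGraph.adj_comm, oddGraph_adj_iff_disjoint_oddFold hΩ hm hw hy] at hyw
    rw [oddGraph_adj_iff_disjoint_oddFold hΩ hm hw hz] at hwz
    -- Here `w` lies in the complement of the union. The complement of one folded set of level `m`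
    -- has `(m + 1) / 2` elements in `x` and `(m + 2) / 2` outside, so the bounds are those of the
    -- upward paths at `t = m`.
    have h6 (s) := Finset.card_le_card (Finset.inter_subset_inter_right (u := s)
      (Finset.subset_compl_iff_disjoint_right.2 (Finset.disjoint_union_right.2 ⟨hyw, hwz⟩)))
    have h7 := h6 x.1
    have h8 := h6 x.1ᶜ
    rw [card_oddFold_inter hΩ] at h7
    rw [card_oddFold_inter_compl hΩ] at h8
    refine ⟨hy, hz, ?_, ?_⟩ <;> rw [hz] at h1 h2 <;> rw [hw] at h7 h8 <;> omega
  · rintro ⟨hy, hz, h6, h7⟩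
    rw [hz] at h1 h2
    obtain ⟨w, hw, -, h8⟩ := exists_oddFold_between hΩ x (t := m) le_rfl
      (Finset.empty_subset (oddFold x y ∪ oddFold x z)ᶜ) (by simp) (by omega) (by simp) (by omega)
    have h11 := Finset.disjoint_union_right.1 (Finset.subset_compl_iff_disjoint_right.1 h8)
    refine ⟨w, ⟨hy, hw, ?_⟩, hw, hz, ?_⟩
    · rw [SimpleGraph.adj_comm, oddGraph_adj_iff_disjoint_oddFold hΩ hm hw hy]
      exact h11.1
    · rw [oddGraph_adj_iff_disjoint_oddFold hΩ hm hw hz]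
      exact h11.2

/-- For `t > 0`, upward and downward paths of length two exchange an element on opposite sides of
`x`, the parity of `t` deciding which. At `t = m` the paths inside the last level replace the upward
ones. At `t = 0` there is only one vertex. -/
theorem realizes_defect_le_one (hΩ : Fintype.card Ω = 2 * m + 1)
    (x : {s : Finset Ω // s.card = m}) {t : ℕ} (ht : t ≤ m) {a b : ℕ} (hab : a + b = 1) :
    Realizes (terwilligerAlgebra (oddGraph Ω m) x) fun y z =>
      (oddFold x y).card = t ∧ (oddFold x z).card = t ∧
        foldDefect x x.1 y z ≤ a ∧ foldDefect x x.1ᶜ y z ≤ b := by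
  rcases t.eq_zero_or_pos with rfl | h0
  · refine (realizes_level hΩ x 0).congr fun y z => ?_
    constructor
    · rintro ⟨h, rfl⟩
      rw [foldDefect_eq_zero_of_subset (Finset.Subset.refl _),
        foldDefect_eq_zero_of_subset (Finset.Subset.refl _)]
      exact ⟨h, h, by omega, by omega⟩
    · rintro ⟨h1, h2, -⟩
      refine ⟨h1, oddFold_injective (x := x) hΩ ?_⟩
      rw [Finset.card_eq_zero.1 h1, Finset.card_eq_zero.1 h2]
  have hdown : ∀ k, t = k + 1 → (k + 1) / 2 - k / 2 = a → Realizes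
      (terwilligerAlgebra (oddGraph Ω m) x) fun y z => (oddFold x y).card = t ∧
        (oddFold x z).card = t ∧ foldDefect x x.1 y z ≤ a ∧ foldDefect x x.1ᶜ y z ≤ b := by
    rintro k rfl hk
    have := realizes_down_up hΩ x k
    rwa [hk, show (k + 2) / 2 - (k + 1) / 2 = b by omega] at this
  have hup : (t + 1) / 2 - t / 2 = a → Realizes
      (terwilligerAlgebra (oddGraph Ω m) x) fun y z => (oddFold x y).card = t ∧
        (oddFold x z).card = t ∧ foldDefect x x.1 y z ≤ a ∧ foldDefect x x.1ᶜ y z ≤ b := by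
    intro hk
    rcases ht.lt_or_eq with h | rfl
    · have := realizes_up_down hΩ x h
      rwa [hk, show (t + 2) / 2 - (t + 1) / 2 = b by omega] at this
    · have := realizes_last_last hΩ x h0
      rwa [hk, show (t + 2) / 2 - (t + 1) / 2 = b by omega] at this
  by_cases h : (t + 1) / 2 - t / 2 = a
  · exact hup h
  · exact hdown (t - 1) (by omega) (by omega)

/-- Single exchanges are composed: `foldDefect_triangle` shows that the composition is no larger
than claimed, `exists_foldDefect_step` that it is no smaller. -/
theorem realizes_defect_le (hΩ : Fintype.card Ω = 2 * m + 1)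
    (x : {s : Finset Ω // s.card = m}) {t : ℕ} (ht : t ≤ m) (a b : ℕ) :
    Realizes (terwilligerAlgebra (oddGraph Ω m) x) fun y z =>
      (oddFold x y).card = t ∧ (oddFold x z).card = t ∧
        foldDefect x x.1 y z ≤ a ∧ foldDefect x x.1ᶜ y z ≤ b := by
  induction a with
  | zero =>
    induction b with
    | zero =>
      refine (realizes_level hΩ x t).congr fun y z => ?_
      constructor
      · rintro ⟨h, rfl⟩
        rw [foldDefect_eq_zero_of_subset (Finset.Subset.refl _),
          foldDefect_eq_zero_of_subset (Finset.Subset.refl _)]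
        exact ⟨h, h, le_rfl, le_rfl⟩
      · rintro ⟨h1, h2, h3, h4⟩
        exact ⟨h1, eq_of_foldDefect_eq_zero hΩ (h1.trans h2.symm) (Nat.le_zero.1 h3)
          (Nat.le_zero.1 h4)⟩
    | succ b ih =>
      refine (ih.comp (realizes_defect_le_one hΩ x ht (zero_add 1))).congr fun y z => ?_
      constructor
      · rintro ⟨w, ⟨h1, h2, h3, h4⟩, -, h5, h6, h7⟩
        have h8 : foldDefect x x.1 y z ≤ _ + _ := foldDefect_triangle (w := w)
        have h9 : foldDefect x x.1ᶜ y z ≤ _ + _ := foldDefect_triangle (w := w)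
        exact ⟨h1, h5, by omega, by omega⟩
      · rintro ⟨h1, h2, h3, h4⟩
        obtain ⟨w, hw, h5, h6, h7, h8⟩ := exists_foldDefect_step hΩ (Or.inr rfl)
          (h1.trans h2.symm) h4 (by rwa [compl_compl] : foldDefect x x.1ᶜᶜ y z ≤ 0)
        rw [compl_compl] at h6 h8
        exact ⟨w, ⟨h1, hw.trans h2, h6, h5⟩, hw.trans h2, h2, h8.le, h7⟩
  | succ a ih =>
    refine (ih.comp (realizes_defect_le_one hΩ x ht (add_zero 1))).congr fun y z => ?_
    constructor
    · rintro ⟨w, ⟨h1, h2, h3, h4⟩, -, h5, h6, h7⟩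
      have h8 : foldDefect x x.1 y z ≤ _ + _ := foldDefect_triangle (w := w)
      have h9 : foldDefect x x.1ᶜ y z ≤ _ + _ := foldDefect_triangle (w := w)
      exact ⟨h1, h5, by omega, by omega⟩
    · rintro ⟨h1, h2, h3, h4⟩
      obtain ⟨w, hw, h5, h6, h7, h8⟩ := exists_foldDefect_step hΩ (Or.inl rfl)
        (h1.trans h2.symm) h3 h4
      exact ⟨w, ⟨h1, hw.trans h2, h5, h6⟩, hw.trans h2, h2, h7, h8.le⟩

theorem realizes_subset (hΩ : Fintype.card Ω = 2 * m + 1)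
    (x : {s : Finset Ω // s.card = m}) {s t : ℕ} (hst : s ≤ t) (ht : t ≤ m) :
    Realizes (terwilligerAlgebra (oddGraph Ω m) x) fun y z =>
      (oddFold x y).card = s ∧ (oddFold x z).card = t ∧ oddFold x y ⊆ oddFold x z := by
  induction t, hst using Nat.le_induction with
  | base =>
    refine (realizes_level hΩ x s).congr fun y z => ?_
    constructor
    · rintro ⟨h, rfl⟩
      exact ⟨h, h, Finset.Subset.refl _⟩
    · rintro ⟨h1, h2, h3⟩
      exact ⟨h1, oddFold_injective (x := x) hΩ
        (Finset.eq_of_subset_of_card_le h3 (h2.trans h1.symm).le)⟩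
  | succ t hst ih =>
    refine ((ih (by omega)).comp (realizes_adj_levels hΩ x t (t + 1))).congr fun y z => ?_
    constructor
    · rintro ⟨w, ⟨h1, h2, h3⟩, -, h4, h5⟩
      rw [oddGraph_adj_iff_subset hΩ (x := x) (by omega)] at h5
      exact ⟨h1, h4, h3.trans h5⟩
    · rintro ⟨h1, h2, h3⟩
      have h4 := card_oddFold_inter hΩ x y
      have h5 := card_oddFold_inter_compl hΩ x y
      have h6 := card_oddFold_inter hΩ x z
      have h7 := card_oddFold_inter_compl hΩ x z
      obtain ⟨w, hw, h8, h9⟩ := exists_oddFold_between hΩ x (t := t) (by omega) h3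
        (by omega) (by omega) (by omega) (by omega)
      exact ⟨w, ⟨h1, hw, h8⟩, hw, h2,
        (oddGraph_adj_iff_subset hΩ (x := x) (by omega)).2 h9⟩

/-- Going from `y` up to a larger `w` and then across level `t` to `z` cannot lower the defects, and
choosing `w` inside the union of the two folded sets does not raise them. -/
theorem realizes_block (hΩ : Fintype.card Ω = 2 * m + 1)
    (x : {s : Finset Ω // s.card = m}) {s t : ℕ} (hst : s ≤ t) (ht : t ≤ m) (a b : ℕ) :
    Realizes (terwilligerAlgebra (oddGraph Ω m) x) fun y z =>
      (oddFold x y).card = s ∧ (oddFold x z).card = t ∧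
        foldDefect x x.1 y z ≤ a ∧ foldDefect x x.1ᶜ y z ≤ b := by
  refine ((realizes_subset hΩ x hst ht).comp (realizes_defect_le hΩ x ht a b)).congr
    fun y z => ?_
  constructor
  · rintro ⟨w, ⟨h1, h2, h3⟩, -, h5, h6, h7⟩
    have h8 : foldDefect x x.1 y z ≤ _ + _ := foldDefect_triangle (w := w)
    have h9 : foldDefect x x.1ᶜ y z ≤ _ + _ := foldDefect_triangle (w := w)
    rw [foldDefect_eq_zero_of_subset h3] at h8 h9
    exact ⟨h1, h5, by omega, by omega⟩
  · rintro ⟨h1, h2, h3, h4⟩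
    have hz1 := card_oddFold_inter hΩ x z
    have hz2 := card_oddFold_inter_compl hΩ x z
    have hy1 := card_oddFold_inter hΩ x y
    have hy2 := card_oddFold_inter_compl hΩ x y
    have h5 := card_inter_add_foldDefect' (x := x) (y := y) (z := z) (s := x.1)
    have h6 := card_inter_add_foldDefect' (x := x) (y := y) (z := z) (s := x.1ᶜ)
    obtain ⟨w, hw, h7, h8⟩ := exists_oddFold_between hΩ x (t := t) ht
      (Finset.subset_union_left : oddFold x y ⊆ oddFold x y ∪ oddFold x z)
      (by omega) (by omega) (by omega) (by omega)
    have h9 (s) : foldDefect x s w z ≤ foldDefect x s y z := by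
      refine Finset.card_le_card (Finset.inter_subset_inter_right fun i hi => ?_)
      rw [mem_sdiff] at hi ⊢
      exact ⟨(mem_union.1 (h8 hi.1)).resolve_right hi.2, hi.2⟩
    exact ⟨w, ⟨h1, hw, h7⟩, hw, h2, (h9 _).trans h3, (h9 _).trans h4⟩

end OddGraphRealizes

/-! ### Orbits of the stabilizer of `x` and the invariant algebra -/

section Orbits

theorem exists_perm_map_of_card_fiber {Ω γ : Type*} [Fintype Ω] [DecidableEq γ] (c c' : Ω → γ)
    (h : ∀ g, (univ.filter fun a => c a = g).card = (univ.filter fun a => c' a = g).card) :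
    ∃ σ : Equiv.Perm Ω, ∀ a, c' (σ a) = c a := by
  have e : ∀ g, Nonempty ({a // c a = g} ≃ {a // c' a = g}) := fun g =>
    ⟨Fintype.equivOfCardEq (by rw [Fintype.card_subtype, Fintype.card_subtype, h g])⟩
  exact ⟨Equiv.ofFiberEquiv fun g => (e g).some, fun a => Equiv.ofFiberEquiv_map _ a⟩

variable {m : ℕ} {Ω : Type*}

/-- The action of a permutation of the ground set on the vertices of the Odd graph. -/
def permVertex (m : ℕ) (σ : Equiv.Perm Ω) : Equiv.Perm {s : Finset Ω // s.card = m} :=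
  (Equiv.finsetCongr σ).subtypeEquiv fun s => by simp

theorem oddGraph_adj_permVertex (σ : Equiv.Perm Ω) (y z : {s : Finset Ω // s.card = m}) :
    (oddGraph Ω m).Adj (permVertex m σ y) (permVertex m σ z) ↔ (oddGraph Ω m).Adj y z := by
  have h : Disjoint (permVertex m σ y).1 (permVertex m σ z).1 ↔ Disjoint y.1 z.1 :=
    Finset.disjoint_map σ.toEmbedding
  change _ ≠ _ ∧ _ ↔ _ ≠ _ ∧ _
  rw [h, (permVertex m σ).injective.ne_iff]

variable [DecidableEq Ω] [Fintype Ω]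

variable {x y z y' z' : {s : Finset Ω // s.card = m}} {σ : Equiv.Perm Ω}

theorem oddFold_permVertex (hσ : x.1.map σ.toEmbedding = x.1) (y : {s : Finset Ω // s.card = m}) :
    oddFold x (permVertex m σ y) = (oddFold x y).map σ.toEmbedding :=
  foldedDiff_map σ hσ y.1

theorem card_oddFold_permVertex (hσ : x.1.map σ.toEmbedding = x.1)
    (y : {s : Finset Ω // s.card = m}) :
    (oddFold x (permVertex m σ y)).card = (oddFold x y).card := by
  rw [oddFold_permVertex hσ, Finset.card_map]

theorem foldDefect_permVertex (hσ : x.1.map σ.toEmbedding = x.1) {s : Finset Ω}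
    (hs : s.map σ.toEmbedding = s) (y z : {s : Finset Ω // s.card = m}) :
    foldDefect x s (permVertex m σ y) (permVertex m σ z) = foldDefect x s y z := by
  unfold foldDefect
  rw [oddFold_permVertex hσ, oddFold_permVertex hσ,
    ← Finset.card_map σ.toEmbedding (s := (oddFold x y \ oddFold x z) ∩ s)]
  congr 1
  conv_lhs => rw [← hs]
  ext a; simp only [mem_inter, mem_sdiff, mem_map_equiv]

/-- The matrices that are invariant under all permutations fixing the vertex `x`. -/
def stabilizerInvariants (x : {s : Finset Ω // s.card = m}) :
    Subalgebra ℂ (Matrix {s : Finset Ω // s.card = m} {s : Finset Ω // s.card = m} ℂ) where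
  carrier := {M | ∀ σ : Equiv.Perm Ω, x.1.map σ.toEmbedding = x.1 →
    ∀ y z, M (permVertex m σ y) (permVertex m σ z) = M y z}
  mul_mem' := by
    intro M N hM hN σ hσ y z
    rw [Matrix.mul_apply, Matrix.mul_apply, ← Equiv.sum_comp (permVertex m σ)]
    exact Finset.sum_congr rfl fun w _ => by rw [hM σ hσ, hN σ hσ]
  add_mem' := by
    intro M N hM hN σ hσ y z
    rw [Matrix.add_apply, Matrix.add_apply, hM σ hσ, hN σ hσ]
  algebraMap_mem' := by
    intro r σ _ y z
    simp only [Matrix.algebraMap_matrix_apply, (permVertex m σ).injective.eq_iff]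

theorem mem_stabilizerInvariants {M} : M ∈ stabilizerInvariants x ↔
    ∀ σ : Equiv.Perm Ω, x.1.map σ.toEmbedding = x.1 →
      ∀ y z, M (permVertex m σ y) (permVertex m σ z) = M y z := Iff.rfl

theorem terwilligerAlgebra_le_stabilizerInvariants (hΩ : Fintype.card Ω = 2 * m + 1)
    (x : {s : Finset Ω // s.card = m}) :
    terwilligerAlgebra (oddGraph Ω m) x ≤ stabilizerInvariants x := by
  classical
  unfold terwilligerAlgebra
  rw [Algebra.adjoin_le_iff]
  rintro M (rfl | ⟨t, -, rfl⟩) σ hσ y z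
  · simp only [SimpleGraph.adjMatrix_apply, oddGraph_adj_permVertex]
  · simp only [dualIdempotent_oddGraph hΩ, Matrix.diagonal_apply,
      (permVertex m σ).injective.eq_iff, card_oddFold_permVertex hσ]

/-- The complete invariant of a pair of vertices under the permutations fixing `x`. -/
def orbitType (x y z : {s : Finset Ω // s.card = m}) : Σ _ : ℕ × ℕ, ℕ × ℕ :=
  ⟨((oddFold x y).card, (oddFold x z).card), (foldDefect x x.1 y z, foldDefect x x.1ᶜ y z)⟩

theorem orbitType_eq_iff : orbitType x y z = orbitType x y' z' ↔
    ((oddFold x y).card = (oddFold x y').card ∧ (oddFold x z).card = (oddFold x z').card) ∧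
      foldDefect x x.1 y z = foldDefect x x.1 y' z' ∧
        foldDefect x x.1ᶜ y z = foldDefect x x.1ᶜ y' z' := by
  simp [orbitType]

theorem orbitType_permVertex (hσ : x.1.map σ.toEmbedding = x.1)
    (y z : {s : Finset Ω // s.card = m}) :
    orbitType x (permVertex m σ y) (permVertex m σ z) = orbitType x y z := by
  have hσ' : x.1ᶜ.map σ.toEmbedding = x.1ᶜ := by
    conv_rhs => rw [← hσ]
    ext a; simp only [mem_compl, mem_map_equiv]
  rw [orbitType_eq_iff, card_oddFold_permVertex hσ, card_oddFold_permVertex hσ,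
    foldDefect_permVertex hσ hσ, foldDefect_permVertex hσ hσ']
  exact ⟨⟨rfl, rfl⟩, rfl, rfl⟩

/-- Colour the points of `Ω` by membership in `x` and in the two folded sets. The type determines
the sizes of all eight colour classes, so some permutation matches the colourings, and folded sets
determine their vertices. -/
theorem exists_permVertex_of_orbitType_eq (hΩ : Fintype.card Ω = 2 * m + 1)
    (h : orbitType x y z = orbitType x y' z') :
    ∃ σ : Equiv.Perm Ω, x.1.map σ.toEmbedding = x.1 ∧ permVertex m σ y = y' ∧
      permVertex m σ z = z' := by
  obtain ⟨⟨hy, hz⟩, hd, hd'⟩ := orbitType_eq_iff.1 h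
  have cells : ∀ s, (s = x.1 ∨ s = x.1ᶜ) → foldDefect x s y z = foldDefect x s y' z' →
      ((oddFold x y ∩ oddFold x z) ∩ s).card = ((oddFold x y' ∩ oddFold x z') ∩ s).card ∧
      foldDefect x s z y = foldDefect x s z' y' ∧
      ((oddFold x y ∪ oddFold x z)ᶜ ∩ s).card = ((oddFold x y' ∪ oddFold x z')ᶜ ∩ s).card := by
    intro s hs hd
    have h1 := card_oddFold_inter_eq hΩ hs hy
    have h2 := card_oddFold_inter_eq hΩ hs hz
    have h3 := card_inter_add_foldDefect (x := x) (y := y) (z := z) (s := s)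
    have h4 := card_inter_add_foldDefect (x := x) (y := y') (z := z') (s := s)
    have h5 := card_inter_add_foldDefect (x := x) (y := z) (z := y) (s := s)
    have h6 := card_inter_add_foldDefect (x := x) (y := z') (z := y') (s := s)
    have h7 := card_inter_add_foldDefect_compl (x := x) (y := y) (z := z) (s := s)
    have h8 := card_inter_add_foldDefect_compl (x := x) (y := y') (z := z') (s := s)
    rw [Finset.inter_comm (oddFold x z)] at h5
    rw [Finset.inter_comm (oddFold x z')] at h6
    refine ⟨?_, ?_, ?_⟩ <;> omega
  obtain ⟨c1, c2, c3⟩ := cells x.1 (Or.inl rfl) hd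
  obtain ⟨d1, d2, d3⟩ := cells x.1ᶜ (Or.inr rfl) hd'
  unfold foldDefect at hd hd' c2 d2
  have color : ∀ (b₁ b₂ b₃ : Bool) (u v : {s : Finset Ω // s.card = m}),
      (univ.filter fun a => (decide (a ∈ x.1), decide (a ∈ oddFold x u), decide (a ∈ oddFold x v)) =
        (b₁, b₂, b₃)) =
      (match b₂, b₃ with
        | true, true => oddFold x u ∩ oddFold x v
        | true, false => oddFold x u \ oddFold x v
        | false, true => oddFold x v \ oddFold x u
        | false, false => (oddFold x u ∪ oddFold x v)ᶜ) ∩ (if b₁ then x.1 else x.1ᶜ) := by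
    intro b₁ b₂ b₃ u v
    ext a
    cases b₁ <;> cases b₂ <;> cases b₃ <;> simp <;> tauto
  obtain ⟨σ, hσ⟩ := exists_perm_map_of_card_fiber
    (fun a => (decide (a ∈ x.1), decide (a ∈ oddFold x y), decide (a ∈ oddFold x z)))
    (fun a => (decide (a ∈ x.1), decide (a ∈ oddFold x y'), decide (a ∈ oddFold x z')))
    (by
      rintro ⟨b₁, b₂, b₃⟩
      rw [color, color]
      cases b₁ <;> cases b₂ <;> cases b₃ <;> assumption)
  simp only [Prod.mk.injEq, decide_eq_decide] at hσ
  have map_eq : ∀ A B : Finset Ω, (∀ a, σ a ∈ B ↔ a ∈ A) → A.map σ.toEmbedding = B := by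
    intro A B hAB
    ext a
    rw [mem_map_equiv, ← hAB, Equiv.apply_symm_apply]
  have hx := map_eq x.1 x.1 fun a => (hσ a).1
  refine ⟨σ, hx, oddFold_injective (x := x) hΩ ?_, oddFold_injective (x := x) hΩ ?_⟩
  · rw [oddFold_permVertex hx]; exact map_eq _ _ fun a => (hσ a).2.1
  · rw [oddFold_permVertex hx]; exact map_eq _ _ fun a => (hσ a).2.2

theorem mem_stabilizerInvariants_iff (hΩ : Fintype.card Ω = 2 * m + 1) {M} :
    M ∈ stabilizerInvariants x ↔
      ∀ y z y' z', orbitType x y z = orbitType x y' z' → M y z = M y' z' := by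
  constructor
  · intro hM y z y' z' h
    obtain ⟨σ, hσ, rfl, rfl⟩ := exists_permVertex_of_orbitType_eq hΩ h
    exact (hM σ hσ y z).symm
  · intro hM σ hσ y z
    exact hM _ _ _ _ (orbitType_permVertex hσ y z)

/-- The key encodes the pair of defects lexicographically, the second being smaller than the base `m
+ 2`. The matrices from `realizes_block` are supported where both defects are bounded, hence where
the key is bounded, so `mem_of_triangular` applies. -/
theorem mem_terwilligerAlgebra_of_block (hΩ : Fintype.card Ω = 2 * m + 1) {s t : ℕ} (hst : s ≤ t)
    (ht : t ≤ m) {M} (hM : M ∈ stabilizerInvariants x)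
    (hM' : ∀ y z, M y z ≠ 0 → (oddFold x y).card = s ∧ (oddFold x z).card = t) :
    M ∈ terwilligerAlgebra (oddGraph Ω m) x := by
  have hlt : ∀ y z, foldDefect x x.1ᶜ y z < m + 2 := fun y z => by
    have h1 : foldDefect x x.1ᶜ y z ≤ (oddFold x y).card :=
      Finset.card_le_card (Finset.inter_subset_left.trans Finset.sdiff_subset)
    have := card_oddFold_le hΩ x y
    omega
  have hκ : ∀ y z y' z', foldDefect x x.1 y z * (m + 2) + foldDefect x x.1ᶜ y z =
      foldDefect x x.1 y' z' * (m + 2) + foldDefect x x.1ᶜ y' z' →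
      foldDefect x x.1 y z = foldDefect x x.1 y' z' ∧
        foldDefect x x.1ᶜ y z = foldDefect x x.1ᶜ y' z' := fun y z y' z' h => by
    have h1 := congrArg (· / (m + 2)) h
    simp only [mul_comm _ (m + 2), Nat.mul_add_div (Nat.succ_pos (m + 1)),
      Nat.div_eq_of_lt (hlt _ _), add_zero] at h1
    rw [h1] at h
    exact ⟨h1, Nat.add_left_cancel h⟩
  have hinv : ∀ N ∈ stabilizerInvariants x, ∀ y z y' z',
      (oddFold x y).card = s ∧ (oddFold x z).card = t →
      (oddFold x y').card = s ∧ (oddFold x z').card = t →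
      foldDefect x x.1 y z * (m + 2) + foldDefect x x.1ᶜ y z =
        foldDefect x x.1 y' z' * (m + 2) + foldDefect x x.1ᶜ y' z' → N y z = N y' z' :=
    fun N hN y z y' z' h1 h2 h3 => (mem_stabilizerInvariants_iff hΩ).1 hN y z y' z'
      (orbitType_eq_iff.2 ⟨⟨h1.1.trans h2.1.symm, h1.2.trans h2.2.symm⟩, hκ _ _ _ _ h3⟩)
  refine mem_of_triangular (fun y z => (oddFold x y).card = s ∧ (oddFold x z).card = t)
    (fun y z => foldDefect x x.1 y z * (m + 2) + foldDefect x x.1ᶜ y z) ?_ hM' (hinv M hM)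
  rintro y₀ z₀ ⟨hy₀, hz₀⟩
  obtain ⟨N, hN, hR⟩ := realizes_block hΩ x hst ht (foldDefect x x.1 y₀ z₀)
    (foldDefect x x.1ᶜ y₀ z₀)
  have hN0 : ∀ y z, N.map (Nat.castRingHom ℂ) y z ≠ 0 ↔ N y z ≠ 0 := fun y z => by simp
  refine ⟨_, hN, fun y z h => ?_, ?_,
    hinv _ (terwilligerAlgebra_le_stabilizerInvariants hΩ x hN)⟩
  · obtain ⟨h1, h2, h3, h4⟩ := (hR y z).1 ((hN0 y z).1 h)
    exact ⟨⟨h1, h2⟩, Nat.add_le_add (Nat.mul_le_mul_right _ h3) h4⟩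
  · exact (hN0 _ _).2 ((hR _ _).2 ⟨hy₀, hz₀, le_rfl, le_rfl⟩)

theorem terwilligerAlgebra_eq_stabilizerInvariants (hΩ : Fintype.card Ω = 2 * m + 1)
    (x : {s : Finset Ω // s.card = m}) :
    terwilligerAlgebra (oddGraph Ω m) x = stabilizerInvariants x := by
  refine le_antisymm (terwilligerAlgebra_le_stabilizerInvariants hΩ x) fun M hM => ?_
  let B (s t : ℕ) : Matrix {s : Finset Ω // s.card = m} {s : Finset Ω // s.card = m} ℂ :=
    Matrix.of fun y z => if (oddFold x y).card = s ∧ (oddFold x z).card = t then M y z else 0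
  have hBsupp (s t y z) (h : B s t y z ≠ 0) :
      (oddFold x y).card = s ∧ (oddFold x z).card = t := by
    by_contra h'
    exact h (if_neg h')
  have hB (s t) : B s t ∈ stabilizerInvariants x := fun σ hσ y z => by
    simp only [B, Matrix.of_apply, card_oddFold_permVertex hσ, hM σ hσ y z]
  have hsum : M = ∑ s ∈ range (m + 1), ∑ t ∈ range (m + 1), B s t := by
    ext y z
    have h1 : (oddFold x y).card < m + 1 := Nat.lt_succ_of_le (card_oddFold_le hΩ x y)
    have h2 : (oddFold x z).card < m + 1 := Nat.lt_succ_of_le (card_oddFold_le hΩ x z)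
    simp only [Matrix.sum_apply]
    rw [Finset.sum_eq_single_of_mem (oddFold x y).card (mem_range.2 h1),
      Finset.sum_eq_single_of_mem (oddFold x z).card (mem_range.2 h2)]
    · exact (if_pos ⟨rfl, rfl⟩).symm
    · exact fun t _ ht => if_neg fun h => ht h.2.symm
    · exact fun s _ hs => Finset.sum_eq_zero fun t _ => if_neg fun h => hs h.1.symm
  rw [hsum]
  refine Subalgebra.sum_mem _ fun s hs => Subalgebra.sum_mem _ fun t ht => ?_
  rw [mem_range, Nat.lt_succ_iff] at hs ht
  rcases le_total s t with h | h
  · exact mem_terwilligerAlgebra_of_block hΩ h ht (hB s t) (hBsupp s t)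
  -- Inclusions only lead upward, so a block with `s > t` is reached through its transpose; the
  -- generators are symmetric.
  · rw [← Matrix.transpose_transpose (B s t)]
    refine transpose_mem_terwilligerAlgebra (mem_terwilligerAlgebra_of_block hΩ h hs ?_ ?_)
    · exact fun σ hσ y z => hB s t σ hσ z y
    · exact fun y z h => (hBsupp s t z y h).symm

theorem finrank_stabilizerInvariants (hΩ : Fintype.card Ω = 2 * m + 1)
    (x : {s : Finset Ω // s.card = m}) :
    Module.finrank ℂ (stabilizerInvariants x) =
      ((univ : Finset ({s : Finset Ω // s.card = m} × {s : Finset Ω // s.card = m})).image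
        fun p => orbitType x p.1 p.2).card := by
  generalize hI : (univ : Finset ({s : Finset Ω // s.card = m} ×
      {s : Finset Ω // s.card = m})).image (fun p => orbitType x p.1 p.2) = I
  have hmemI (i) : i ∈ I ↔ ∃ y z, orbitType x y z = i := by
    rw [← hI, Finset.mem_image]
    exact ⟨fun ⟨p, _, hp⟩ => ⟨p.1, p.2, hp⟩, fun ⟨y, z, h⟩ => ⟨(y, z), mem_univ _, h⟩⟩
  have hmem (y z) : orbitType x y z ∈ I := (hmemI _).2 ⟨y, z, rfl⟩
  let L : (I → ℂ) →ₗ[ℂ]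
      Matrix {s : Finset Ω // s.card = m} {s : Finset Ω // s.card = m} ℂ :=
    { toFun := fun f => Matrix.of fun y z => f ⟨orbitType x y z, hmem y z⟩
      map_add' := fun f g => rfl
      map_smul' := fun r f => rfl }
  have hL : Function.Injective L := by
    intro f g hfg
    ext ⟨i, hi⟩
    obtain ⟨y, z, rfl⟩ := (hmemI i).1 hi
    exact congrFun (congrFun hfg y) z
  have hrange : LinearMap.range L = Subalgebra.toSubmodule (stabilizerInvariants x) := by
    ext M
    rw [Subalgebra.mem_toSubmodule, mem_stabilizerInvariants_iff hΩ]
    constructor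
    · rintro ⟨f, rfl⟩ y z y' z' h
      change f _ = f _
      congr 2
    · intro hM
      choose p q hp using fun i : I => (hmemI i).1 i.2
      refine ⟨fun i => M (p i) (q i), ?_⟩
      ext y z
      exact hM _ _ _ _ (hp ⟨orbitType x y z, hmem y z⟩)
  rw [← Subalgebra.finrank_toSubmodule, ← hrange, LinearMap.finrank_range_of_inj hL,
    Module.finrank_fintype_fun_eq_card, Fintype.card_coe]

/-- The lower bounds say that what `y` shares with `z` fits into `z` on each side. What `y` has
outside `z` always fits, since `s, t ≤ m` gives `s / 2 + t / 2 ≤ m` and `(s + 1) / 2 + (t + 1) / 2 ≤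
m + 1`. -/
theorem image_orbitType (hΩ : Fintype.card Ω = 2 * m + 1) (x : {s : Finset Ω // s.card = m}) :
    ((univ : Finset ({s : Finset Ω // s.card = m} × {s : Finset Ω // s.card = m})).image
        fun p => orbitType x p.1 p.2) =
      (range (m + 1) ×ˢ range (m + 1)).sigma fun p =>
        Icc (p.1 / 2 - p.2 / 2) (p.1 / 2) ×ˢ
          Icc ((p.1 + 1) / 2 - (p.2 + 1) / 2) ((p.1 + 1) / 2) := by
  ext ⟨⟨s, t⟩, a, b⟩
  simp only [mem_image, mem_univ, true_and, mem_sigma, mem_product, mem_range, mem_Icc]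
  constructor
  · rintro ⟨⟨y, z⟩, h⟩
    simp only [orbitType, Sigma.mk.injEq, Prod.mk.injEq, heq_eq_eq] at h
    obtain ⟨⟨rfl, rfl⟩, rfl, rfl⟩ := h
    have h1 := card_oddFold_inter hΩ x y
    have h2 := card_oddFold_inter_compl hΩ x y
    have h3 := card_oddFold_inter hΩ x z
    have h4 := card_oddFold_inter_compl hΩ x z
    have h5 := card_inter_add_foldDefect (x := x) (y := y) (z := z) (s := x.1)
    have h6 := card_inter_add_foldDefect (x := x) (y := y) (z := z) (s := x.1ᶜ)
    have h7 (s) : ((oddFold x y ∩ oddFold x z) ∩ s).card ≤ (oddFold x z ∩ s).card :=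
      Finset.card_le_card (Finset.inter_subset_inter_right Finset.inter_subset_right)
    have h8 := h7 x.1
    have h9 := h7 x.1ᶜ
    have h10 := card_oddFold_le hΩ x y
    have h11 := card_oddFold_le hΩ x z
    omega
  · rintro ⟨⟨hs, ht⟩, ⟨ha, ha'⟩, hb, hb'⟩
    have hx := Finset.card_compl x.1
    have hx' := x.2
    rw [hΩ] at hx
    obtain ⟨z, hz, -, -⟩ := exists_oddFold_between hΩ x (t := t) (by omega)
      (Finset.subset_univ ∅) (by simp) (by rw [univ_inter]; omega) (by simp)
      (by rw [univ_inter]; omega)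
    have h3 := card_oddFold_inter hΩ x z
    have h4 := card_oddFold_inter_compl hΩ x z
    have hc (s : Finset Ω) : ((oddFold x z)ᶜ ∩ s).card + (oddFold x z ∩ s).card = s.card := by
      rw [Finset.inter_comm, Finset.inter_comm _ s, ← Finset.sdiff_eq_inter_compl,
        Finset.card_sdiff_add_card_inter]
    have h5 := hc x.1
    have h6 := hc x.1ᶜ
    -- `P` is to be the part of `y` shared with `z`, and `Q` the part lost, so that `Q` carries the
    -- defects `a` and `b`.
    obtain ⟨P, -, hP, hP1, hP2⟩ := Finset.exists_between_card_inter
      (Finset.empty_subset (oddFold x z)) x.1 (a := s / 2 - a) (b := (s + 1) / 2 - b)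
      (by simp) (by omega) (by simp) (by omega)
    obtain ⟨Q, -, hQ, hQ1, hQ2⟩ := Finset.exists_between_card_inter
      (Finset.empty_subset (oddFold x z)ᶜ) x.1 (a := a) (b := b)
      (by simp) (by omega) (by simp) (by omega)
    have hdisj : Disjoint P Q :=
      Finset.disjoint_of_subset_left hP (Finset.subset_compl_iff_disjoint_left.1 hQ)
    have hPQ (u : Finset Ω) : ((P ∪ Q) ∩ u).card = (P ∩ u).card + (Q ∩ u).card := by
      rw [Finset.union_inter_distrib_right, Finset.card_union_of_disjoint]
      exact Finset.disjoint_of_subset_left inter_subset_left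
        (Finset.disjoint_of_subset_right inter_subset_left hdisj)
    obtain ⟨y, hy⟩ := exists_oddFold_eq hΩ x (t := s) (by omega) (S := P ∪ Q)
      (by rw [hPQ]; omega) (by rw [hPQ]; omega)
    have h1 := card_oddFold_inter hΩ x y
    have h2 := card_oddFold_inter_compl hΩ x y
    have hcard : (oddFold x y).card = s := by
      have := Finset.card_inter_add_card_sdiff (oddFold x y) x.1
      rw [Finset.sdiff_eq_inter_compl, hy, hPQ, hPQ] at this
      rw [hy]; omega
    have hdef (u) : foldDefect x u y z = (Q ∩ u).card := by
      unfold foldDefect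
      rw [hy, Finset.union_sdiff_distrib, Finset.sdiff_eq_empty_iff_subset.2 hP, Finset.empty_union,
        Finset.sdiff_eq_self_of_disjoint (Finset.subset_compl_iff_disjoint_right.1 hQ)]
    refine ⟨(y, z), ?_⟩
    simp only [orbitType, hcard, hz, hdef, hQ1, hQ2]

end Orbits

/-! ### Counting orbit types -/

section Count

theorem Finset.sum_range_sum_range_min (g : ℕ → ℕ) (n : ℕ) :
    ∑ s ∈ range (n + 1), ∑ t ∈ range (n + 1), g (min s t) =
      ∑ s ∈ range n, ∑ t ∈ range n, g (min s t) + (2 * ∑ s ∈ range n, g s + g n) := by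
  have h1 : ∀ s ∈ range n, ∑ t ∈ range (n + 1), g (min s t) =
      ∑ t ∈ range n, g (min s t) + g s := fun s hs => by
    rw [Finset.sum_range_succ, min_eq_left (mem_range.1 hs).le]
  have h2 : ∑ t ∈ range (n + 1), g (min n t) = ∑ t ∈ range n, g t + g n := by
    rw [Finset.sum_range_succ, min_self]
    congr 1
    exact Finset.sum_congr rfl fun t ht => by rw [min_eq_right (mem_range.1 ht).le]
  rw [Finset.sum_range_succ, Finset.sum_congr rfl h1, Finset.sum_add_distrib, h2]
  ring

/-- The common factor is `(t + 1) / 2 + 1`. Its double and the sum of the two other factors are `t +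
2` and `t + 3` in some order. -/
theorem quarter_square_add (t : ℕ) :
    (t / 2 + 1) * ((t + 1) / 2 + 1) + ((t + 1) / 2 + 1) * ((t + 2) / 2 + 1) =
      (t + 3).choose 2 := by
  rw [Nat.choose_two_right]
  rcases Nat.even_or_odd' t with ⟨k, rfl | rfl⟩
  · rw [show 2 * k / 2 = k by omega, show (2 * k + 1) / 2 = k by omega,
      show (2 * k + 2) / 2 = k + 1 by omega, eq_comm]
    apply Nat.div_eq_of_eq_mul_right two_pos
    rw [show 2 * k + 3 - 1 = 2 * k + 2 by omega]; ring
  · rw [show (2 * k + 1) / 2 = k by omega, show (2 * k + 1 + 1) / 2 = k + 1 by omega,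
      show (2 * k + 1 + 2) / 2 = k + 1 by omega, eq_comm]
    apply Nat.div_eq_of_eq_mul_right two_pos
    rw [show 2 * k + 1 + 3 - 1 = 2 * k + 3 by omega]; ring

/-- The left side is the contribution of the last row and column in
`Finset.sum_range_sum_range_min`. Its increments are the binomials of `quarter_square_add`. -/
theorem two_mul_sum_quarter_square (n : ℕ) :
    2 * ∑ t ∈ range n, (t / 2 + 1) * ((t + 1) / 2 + 1) + (n / 2 + 1) * ((n + 1) / 2 + 1) =
      (n + 3).choose 3 := by
  induction n with
  | zero => rfl
  | succ n ih =>
    have h := quarter_square_add n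
    rw [Finset.sum_range_succ, Nat.choose_succ_succ' (n + 3) 2, ← ih, ← h]
    ring

theorem sum_min_quarter_square (m : ℕ) :
    ∑ s ∈ range (m + 1), ∑ t ∈ range (m + 1),
      ((min s t) / 2 + 1) * ((min s t + 1) / 2 + 1) = (m + 4).choose 4 := by
  induction m with
  | zero => rfl
  | succ m ih =>
    rw [Finset.sum_range_sum_range_min (fun t => (t / 2 + 1) * ((t + 1) / 2 + 1)), ih,
      two_mul_sum_quarter_square, Nat.choose_succ_succ' (m + 4) 3, add_comm]

theorem card_orbitTypes (m : ℕ) :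
    ((range (m + 1) ×ˢ range (m + 1)).sigma fun p : ℕ × ℕ =>
        Icc (p.1 / 2 - p.2 / 2) (p.1 / 2) ×ˢ
          Icc ((p.1 + 1) / 2 - (p.2 + 1) / 2) ((p.1 + 1) / 2)).card = (m + 4).choose 4 := by
  rw [Finset.card_sigma, Finset.sum_product, ← sum_min_quarter_square]
  refine Finset.sum_congr rfl fun s _ => Finset.sum_congr rfl fun t _ => ?_
  rw [Finset.card_product, Nat.card_Icc, Nat.card_Icc]
  -- With truncated subtraction `u - (u - v)` is `min u v`, and halving is monotone, so it commutes
  -- with `min`.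
  congr 1 <;> omega

end Count

theorem corollary3p7 (m : ℕ) (Ω : Type*) [Fintype Ω] [DecidableEq Ω]
    (hΩ : Fintype.card Ω = 2 * m + 1) (x : {s : Finset Ω // s.card = m}) :
    Module.finrank ℂ (terwilligerAlgebra (oddGraph Ω m) x) = (m + 4).choose 4 := by
  rw [terwilligerAlgebra_eq_stabilizerInvariants hΩ, finrank_stabilizerInvariants hΩ,
    image_orbitType hΩ, card_orbitTypes]
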